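/- **Theorem (Counting FloodSet).** Consider $n$ agents with initial values in $\{0,1\}$ in a synchronous message-passing system with at most $t<n$ crash failures: a faulty agent behaves correctly until it crashes in some round; in that round an arbitrary subset of its messages is delivered, and it sends nothing afterwards. In the Counting FloodSet information exchange $\mathcal E$, the local state of an agent is either $\mathit{crashed}$ or a tuple $\langle W,h,m,v\rangle$, where $W$ is the set of values seen so far, $h$ is the number of agents from which no message was received in the last round, $m$ is the time and $v$ is the agent's initial value; it is $\langle\{v\},0,0,v\rangle$ at time $0$. In each round every non-crashed agent sends $W$ to all agents, itself included, and, unless it crashes, adds the received sets to $W$, records the new count $h$ and increments $m$. Decisions do not influence these states. Let $\mathcal I$ be the system of all runs (all initial values and all crash patterns with at most $t$ faulty agents). At a point $(r,m)$, let $\mathcal N(r,m)$ be the set of agents that are not crashed. An agent knows a proposition at a point if it is true at all points of $\mathcal I$ at which the agent has the same local state. $C_{\mathcal N}\varphi$ (common knowledge) means that $E_{\mathcal N}^k\varphi$ holds for all $k\ge 1$, where $E_{\mathcal N}\varphi$ holds at a point if every agent in $\mathcal N$ at that point knows $\varphi$ there. Let $\exists v$ be the proposition that some agent has initial value $v$.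 1. Let $r$ be a run, $m$ a time, and $i$ an agent with local state $\langle W,h,m,v_i\rangle$ at $(r,m)$. Then $C_{\mathcal N}(\exists 0)\vee C_{\mathcal N}(\exists 1)$ holds at $(r,m)$ if and only if $m\ge\min\{t+1,n-1\}$ or $h\ge n-1$. 2. A decision protocol maps the local states of each agent to the actions $\mathtt{decide}(0)$, $\mathtt{decide}(1)$, $\mathtt{noop}$; an agent decides $w$ at $(r,m)$ if it is not crashed at $(r,m)$ and its action there is $\mathtt{decide}(w)$. A decision protocol is an SBA protocol if in every run (Agreement) all decisions, by any agents at any times, are on the same value; (Validity) every decided value is the initial value of some agent; and (Simultaneity) if some agent decides at time $m$, then every agent in $\mathcal N(r,m)$ decides at time $m$. Let $P$ be the protocol in which an agent in state $\langle W,h,m,v\rangle$ performs $\mathtt{decide}(\min W)$ if $m\ge\min\{t+1,n-1\}$ or $h\ge n-1$, and $\mathtt{noop}$ otherwise. Then $P$ is an optimum SBA protocol with respect to $\mathcal E$: it is an SBA protocol, and for every SBA protocol $P'$ with the same information exchange and every pair of runs of $P'$ and $P$ with the same initial values and the same crash pattern, whenever an agent decides at time $m$ in the run of $P'$, it also decides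 at time $m$ in the run of $P$. Moreover, under $P$ every agent eventually decides or crashes. -/

import Mathlib

namespace SBA

/-- The set of initial values `{0, 1}`, ordered by `0 < 1`. -/
abbrev Value := Fin 2

/-- The actions of an agent: decide on a value, or do nothing. -/
inductive Action where
  | decideOn (v : Value)
  | noop

/-- States of the environment. `F m i j = true` means that a message from `i` to `j` is delivered
in the round that leads from time `m` to time `m + 1`; `F m i i = false` means that `i` has crashed
in that round or before. -/
abbrev Adversary (n : ℕ) := ℕ → Fin n → Fin n → Bool

/-- The hard crash failure model with at most `t` faulty agents: an agent that fails to deliver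
some message crashes in that very round; after a crash it never sends anything again. -/
def Crash (n t : ℕ) : Set (Adversary n) :=
  {F | (∀ m i j, F m i j = false → F m i i = false) ∧
       (∀ m i, F m i i = false → ∀ m', m < m' → ∀ k, F m' i k = false) ∧
       {i : Fin n | ∃ m j, F m i j = false}.ncard ≤ t}

/-- Information exchange protocols for `n` agents. The value `none` of an `Option` stands for
`⊥` (no message). The map `initState i` is the inverse of the bijection between the initial states
of `i` and the initial values, so that the initial states of `i` are the values of
`initState i`. -/
structure InfoExchange (n : ℕ) where
  State : Fin n → Type
  Msg : Fin n → Type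
  crashed : ∀ i, State i
  initState : ∀ i, Value → State i
  initState_injective : ∀ i, Function.Injective (initState i)
  send : ∀ i, State i → Action → Fin n → Option (Msg i)
  update : ∀ i, State i → Adversary n → Action → (∀ j, Option (Msg j)) → State i

variable {n : ℕ}

/-- A decision protocol: for each agent, a map from its local states to actions. -/
abbrev DecisionProtocol (E : InfoExchange n) := ∀ i, E.State i → Action

/-- A global state: a state of the environment and a local state of each agent. -/
structure GlobalState (E : InfoExchange n) where
  env : Adversary n
  loc : ∀ i, E.State i

/-- A run maps times to global states; a point is a run together with a time. -/
abbrev Run (E : InfoExchange n) := ℕ → GlobalState E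

/-- The round from time `k` to time `k + 1`, starting in the global state `g`. -/
def step (E : InfoExchange n) (P : DecisionProtocol E) (k : ℕ) (g : GlobalState E) :
    GlobalState E where
  env := g.env
  loc i := E.update i (g.loc i) g.env (P i (g.loc i)) fun j =>
    if g.env k j i = true then E.send j (g.loc j) (P j (g.loc j)) i else none

/-- The set of runs of the decision protocol `P` with the information exchange `E` in the crash
failure model with at most `t` failures. -/
def system (E : InfoExchange n) (t : ℕ) (P : DecisionProtocol E) : Set (Run E) :=
  {r | (r 0).env ∈ Crash n t ∧ (∀ i, ∃ v, (r 0).loc i = E.initState i v) ∧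
       ∀ k, r (k + 1) = step E P k (r k)}

section Knowledge

variable {E : InfoExchange n}

/-- The set of agents that have not failed at a point. -/
def nonfailed (r : Run E) (m : ℕ) : Set (Fin n) := {i | (r m).loc i ≠ E.crashed i}

/-- Propositions that are evaluated at points. -/
abbrev Proposition (E : InfoExchange n) := Run E → ℕ → Prop

/-- Some agent has the initial value `v`. -/
def existsValue (v : Value) : Proposition E := fun r _ => ∃ i, (r 0).loc i = E.initState i v

/-- Agent `i` knows `φ`, in the system of runs `R`. -/
def Knows (R : Set (Run E)) (i : Fin n) (φ : Proposition E) : Proposition E := fun r m =>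
  ∀ r' ∈ R, ∀ m', (r m).loc i = (r' m').loc i → φ r' m'

/-- Every nonfailed agent knows `φ`. -/
def EveryoneKnows (R : Set (Run E)) (φ : Proposition E) : Proposition E := fun r m =>
  ∀ i ∈ nonfailed r m, Knows R i φ r m

/-- `φ` is common knowledge among the nonfailed agents. -/
def CommonKnowledge (R : Set (Run E)) (φ : Proposition E) : Proposition E := fun r m =>
  ∀ k, 1 ≤ k → (EveryoneKnows R)^[k] φ r m

end Knowledge

section Agreement

variable {E : InfoExchange n}

/-- Agent `i` is nonfailed at the point `(r, m)` and decides `v` there (in round `m + 1`). -/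
def Decides (P : DecisionProtocol E) (r : Run E) (m : ℕ) (i : Fin n) (v : Value) : Prop :=
  i ∈ nonfailed r m ∧ P i ((r m).loc i) = Action.decideOn v

/-- Simultaneous Byzantine Agreement protocols with respect to `E`. -/
structure IsSBA (E : InfoExchange n) (t : ℕ) (P : DecisionProtocol E) : Prop where
  agreement : ∀ r ∈ system E t P, ∀ m m' i j v v',
    Decides P r m i v → Decides P r m' j v' → v = v'
  validity : ∀ r ∈ system E t P, ∀ m i v, Decides P r m i v → existsValue v r m
  simultaneity : ∀ r ∈ system E t P, ∀ m i v, Decides P r m i v →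
    ∀ j ∈ nonfailed r m, ∃ w, Decides P r m j w

/-- Every agent eventually decides or fails. -/
def Terminates (E : InfoExchange n) (t : ℕ) (P : DecisionProtocol E) : Prop :=
  ∀ r ∈ system E t P, ∀ i, ∃ m, i ∉ nonfailed r m ∨ ∃ v, Decides P r m i v

/-- Two runs correspond if they have the same initial values and the same adversary. -/
def Corresponds (r r' : Run E) : Prop :=
  (∀ i v, (r 0).loc i = E.initState i v ↔ (r' 0).loc i = E.initState i v) ∧
    (r 0).env = (r' 0).env

/-- In corresponding runs, whenever a nonfailed agent decides under `P`, it also decides under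
`P'` (possibly on another value). -/
def DecidesNoMoreThan (E : InfoExchange n) (t : ℕ) (P P' : DecisionProtocol E) : Prop :=
  ∀ r ∈ system E t P, ∀ r' ∈ system E t P', Corresponds r r' →
    ∀ m i v, Decides P r m i v → ∃ w, Decides P' r' m i w

/-- Optimum SBA protocols with respect to `E`. -/
def IsOptimumSBA (E : InfoExchange n) (t : ℕ) (P : DecisionProtocol E) : Prop :=
  IsSBA E t P ∧ ∀ P' : DecisionProtocol E, IsSBA E t P' → DecidesNoMoreThan E t P' P

end Agreement

/-- The local states of an agent of Counting FloodSet that has not crashed: the set of values seen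
so far, the number of messages missing in the last round, the time, and the initial value. -/
@[ext]
structure CountState where
  seen : Finset Value
  missing : ℕ
  time : ℕ
  init : Value

/-- The Counting FloodSet information exchange. The local state `none` is the crashed state.
A message is delivered to its sender, too, if the sender does not crash. -/
def countFloodSet (n : ℕ) : InfoExchange n where
  State _ := Option CountState
  Msg _ := Finset Value
  crashed _ := none
  initState _ v := some ⟨{v}, 0, 0, v⟩
  initState_injective _ v w h := by
    simpa using congrArg (Option.map CountState.init) h
  send _ s _ _ := s.map CountState.seen
  update i s F _ msgs := s.bind fun s =>
    if F s.time i i = false then none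
    else some
      { seen := s.seen ∪ Finset.univ.biUnion fun j => (msgs j).getD ∅
        missing := (Finset.univ.filter fun j => msgs j = none).card
        time := s.time + 1
        init := s.init }

/-- The Counting FloodSet decision rule. For a nonempty set `W` of values, `W.inf id` is its
minimum. -/
def countRule (n t : ℕ) : DecisionProtocol (countFloodSet n) := fun _ s =>
  match (s : Option CountState) with
  | none => Action.noop
  | some s =>
    if min (t + 1) (n - 1) ≤ s.time then Action.decideOn (s.seen.inf id)
    else if n - 1 ≤ s.missing then Action.decideOn (s.seen.inf id)
    else Action.noop

end SBA

/-!
As long as some agent crashes in every round, the number of crashed agents is at least the time;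
after a round without a crash all live agents have heard from the same agents, for ever. So from
time `min (t + 1) (n - 1)` on all live agents have seen the same values. The same holds when `n - 1`
messages to a live agent are missing, because this agent is then the only live one. Both conditions
can be read off the local state of each live agent, so a value that has been seen is then common
knowledge.

Conversely, common knowledge is inherited along chains of scenarios in which some live agent has
the same local state at both ends of each link. Suppose that `m ≤ t`, `m ≤ n - 2` and that a live
agent has received a message from another agent. It cannot exclude that every crash it noticed took
place in the last round and was noticed by nobody else; the agent it heard from then cannot exclude
that there was no crash at all. Among failure-free scenarios in which both values occur, an agent
that keeps its initial value sees no difference. Finally, in a scenario where a single agent has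
the other value and that value is passed on only along a chain of agents, each crashing right
after it has passed on the value, the live end of the chain has seen both values and all later
agents have seen only one. So every scenario is linked to those in which all agents start with `0`
and to those in which all start with `1`, and neither value is commonly known.
-/

namespace SBA

variable {n t : ℕ}

section Flooding

variable {F : Adversary n} {k m : ℕ} {i j : Fin n}

/-- Agent `i` has not crashed by time `k`. -/
def Alive (F : Adversary n) (k : ℕ) (i : Fin n) : Prop := ∀ k' < k, F k' i i = true

instance : Decidable (Alive F k i) := Nat.decidableBallLT k fun k' _ => F k' i i = true

/-- The agents whose initial values have reached agent `i` by time `k`, if every agent forwards all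
it knows in each round. -/
def heardFrom (F : Adversary n) : ℕ → Fin n → Finset (Fin n)
  | 0, i => {i}
  | k + 1, i => heardFrom F k i ∪
      Finset.univ.biUnion fun j => if F k j i = true then heardFrom F k j else ∅

/-- The number of messages to agent `i` that are missing in the round that ends at time `k`; it is
`0` at time `0`. -/
def missingCount (F : Adversary n) : ℕ → Fin n → ℕ
  | 0, _ => 0
  | k + 1, i => (Finset.univ.filter fun j => F k j i = false).card

/-- All agents alive at time `k` have heard from the same agents. -/
def HeardUniformly (F : Adversary n) (k : ℕ) : Prop :=
  ∀ i j, Alive F k i → Alive F k j → heardFrom F k i = heardFrom F k j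

theorem mem_heardFrom_succ {a : Fin n} :
    a ∈ heardFrom F (k + 1) i ↔
      a ∈ heardFrom F k i ∨ ∃ j, F k j i = true ∧ a ∈ heardFrom F k j := by
  simp only [heardFrom, Finset.mem_union, Finset.mem_biUnion, Finset.mem_univ, true_and]
  refine or_congr_right (exists_congr fun j => ?_)
  split_ifs with h <;> simp [h]

theorem self_mem_heardFrom (F : Adversary n) (k : ℕ) (i : Fin n) : i ∈ heardFrom F k i := by
  induction k with
  | zero => exact Finset.mem_singleton_self i
  | succ k ih => exact mem_heardFrom_succ.2 (.inl ih)

theorem mem_heardFrom_succ_of_delivered (h : F k j i = true) : j ∈ heardFrom F (k + 1) i :=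
  mem_heardFrom_succ.2 (.inr ⟨j, h, self_mem_heardFrom F k j⟩)

theorem Alive.mono (h : Alive F m i) (hk : k ≤ m) : Alive F k i :=
  fun k' hk' => h k' (hk'.trans_le hk)

theorem alive_zero (F : Adversary n) (i : Fin n) : Alive F 0 i :=
  fun _ hk' => absurd hk' (Nat.not_lt_zero _)

theorem alive_succ : Alive F (k + 1) i ↔ Alive F k i ∧ F k i i = true :=
  Nat.forall_lt_succ_right

theorem alive_of_delivered (hF : F ∈ Crash n t) (h : F k i j = true) : Alive F k i := by
  intro k' hk'
  by_contra hcrash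
  have hsilent := hF.2.1 k' i (Bool.eq_false_of_not_eq_true hcrash) k hk' j
  exact Bool.false_ne_true (hsilent.symm.trans h)

theorem Alive.delivered (hF : F ∈ Crash n t) (h : Alive F (k + 1) i) (j : Fin n) :
    F k i j = true := by
  by_contra hlost
  have hcrash := hF.1 k i j (Bool.eq_false_of_not_eq_true hlost)
  exact Bool.false_ne_true (hcrash.symm.trans (alive_succ.1 h).2)

theorem missingCount_le (hF : F ∈ Crash n t) (k : ℕ) (i : Fin n) : missingCount F k i ≤ t := by
  cases k with
  | zero => exact Nat.zero_le t
  | succ k =>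
    refine le_trans ?_ hF.2.2
    rw [missingCount, ← Set.ncard_coe_finset]
    exact Set.ncard_le_ncard (fun j hj => ⟨k, i, by simpa using hj⟩) (Set.toFinite _)

theorem card_crashed_le (hF : F ∈ Crash n t) (k : ℕ) :
    (Finset.univ.filter fun i => ¬ Alive F k i).card ≤ t := by
  refine le_trans ?_ hF.2.2
  rw [← Set.ncard_coe_finset]
  refine Set.ncard_le_ncard (fun i hi => ?_) (Set.toFinite _)
  obtain ⟨k', -, h⟩ : ∃ k' < k, ¬ F k' i i = true := by simpa [Alive] using hi
  exact ⟨k', i, Bool.eq_false_of_not_eq_true h⟩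

theorem HeardUniformly.heardFrom_eq (hF : F ∈ Crash n t) (h : HeardUniformly F k) (hkm : k ≤ m)
    (hi : Alive F k i) (hj : Alive F m j) : heardFrom F m j = heardFrom F k i := by
  induction m, hkm using Nat.le_induction generalizing j with
  | base => exact h j i hj hi
  | succ m _ ih =>
    ext a
    rw [mem_heardFrom_succ, ih (hj.mono m.le_succ)]
    refine ⟨?_, Or.inl⟩
    rintro (ha | ⟨l, hl, ha⟩)
    · exact ha
    · rwa [ih (alive_of_delivered hF hl)] at ha

theorem heardUniformly_succ_of_no_crash (hF : F ∈ Crash n t)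
    (h : ∀ i, Alive F k i → Alive F (k + 1) i) : HeardUniformly F (k + 1) := by
  have mem_iff : ∀ {i a}, Alive F (k + 1) i →
      (a ∈ heardFrom F (k + 1) i ↔ ∃ j, Alive F k j ∧ a ∈ heardFrom F k j) := by
    intro i a hi
    rw [mem_heardFrom_succ]
    constructor
    · rintro (ha | ⟨j, hj, ha⟩)
      exacts [⟨i, hi.mono k.le_succ, ha⟩, ⟨j, alive_of_delivered hF hj, ha⟩]
    · rintro ⟨j, hj, ha⟩
      exact .inr ⟨j, (h j hj).delivered hF i, ha⟩
  intro i j hi hj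
  ext a
  rw [mem_iff hi, mem_iff hj]

theorem heardUniformly_or_le_card_crashed (hF : F ∈ Crash n t) (k : ℕ) :
    HeardUniformly F k ∨ k ≤ (Finset.univ.filter fun i => ¬ Alive F k i).card := by
  induction k with
  | zero => exact .inr (Nat.zero_le _)
  | succ k ih =>
    obtain huniform | hcard := ih
    · exact .inl fun i j hi hj => (huniform.heardFrom_eq hF k.le_succ (hi.mono k.le_succ) hi).trans
        (huniform.heardFrom_eq hF k.le_succ (hi.mono k.le_succ) hj).symm
    by_cases hno_crash : ∀ i, Alive F k i → Alive F (k + 1) i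
    · exact .inl (heardUniformly_succ_of_no_crash hF hno_crash)
    · push Not at hno_crash
      obtain ⟨i, hi, hi'⟩ := hno_crash
      refine .inr (hcard.trans_lt (Finset.card_lt_card ?_))
      refine Finset.ssubset_iff_of_subset ?_ |>.2 ⟨i, by simpa using hi', by simpa using hi⟩
      exact Finset.monotone_filter_right _ fun j _ hj h => hj (h.mono k.le_succ)

theorem heardUniformly_of_min_le (hF : F ∈ Crash n t) (hk : min (t + 1) (n - 1) ≤ k) :
    HeardUniformly F k := by
  refine (heardUniformly_or_le_card_crashed hF k).elim id fun hcard i j hi hj => ?_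
  have hcrashed := card_crashed_le hF k
  have halive := Finset.card_filter_add_card_filter_not (s := Finset.univ) (Alive F k)
  rw [Finset.card_univ, Fintype.card_fin] at halive
  have honly : (Finset.univ.filter (Alive F k)).card ≤ 1 := by omega
  rw [Finset.card_le_one.1 honly i (by simpa using hi) j (by simpa using hj)]

theorem eq_of_le_missingCount (hF : F ∈ Crash n t) (hmissing : n - 1 ≤ missingCount F k i)
    (hi : Alive F k i) (hj : Alive F k j) : i = j := by
  cases k with
  | zero =>
    have hn : n - 1 ≤ 0 := hmissing
    exact Fin.ext (by omega)
  | succ k =>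
    have hsplit := Finset.card_filter_add_card_filter_not (s := Finset.univ)
      fun a => F k a i = false
    rw [Finset.card_univ, Fintype.card_fin] at hsplit
    have hreceived : (Finset.univ.filter fun a => ¬ F k a i = false).card ≤ 1 := by
      rw [missingCount] at hmissing
      omega
    exact Finset.card_le_one.1 hreceived i (by simp [hi.delivered hF]) j (by simp [hj.delivered hF])

end Flooding

section Scenarios

/-- The data that determine a run of Counting FloodSet up to the decisions: the initial values and
the adversary. -/
structure Scenario (n t : ℕ) where
  values : Fin n → Value
  adversary : Adversary n
  adversary_mem : adversary ∈ Crash n t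

namespace Scenario

/-- The set of values that agent `i` has seen by time `k`. -/
def seen (S : Scenario n t) (k : ℕ) (i : Fin n) : Finset Value :=
  (heardFrom S.adversary k i).image S.values

/-- The local state of agent `i` at time `k` in the runs with the scenario `S`. -/
def localState (S : Scenario n t) (k : ℕ) (i : Fin n) : Option CountState :=
  if Alive S.adversary k i then
    some ⟨S.seen k i, missingCount S.adversary k i, k, S.values i⟩
  else none

/-- The run `r` starts with the initial values and the adversary of `S`. -/
def Initiates (S : Scenario n t) (r : Run (countFloodSet n)) : Prop :=
  (r 0).env = S.adversary ∧ ∀ i, (r 0).loc i = (countFloodSet n).initState i (S.values i)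

variable {S : Scenario n t} {k m : ℕ} {i : Fin n} {w : Value}

theorem localState_eq_some_iff {s : CountState} : S.localState k i = some s ↔
    Alive S.adversary k i ∧ ⟨S.seen k i, missingCount S.adversary k i, k, S.values i⟩ = s := by
  rw [localState]
  split_ifs with h <;> simp [h]

theorem value_mem_seen (S : Scenario n t) (k : ℕ) (i : Fin n) : S.values i ∈ S.seen k i :=
  Finset.mem_image_of_mem _ (self_mem_heardFrom S.adversary k i)

theorem send_localState (S : Scenario n t) (k : ℕ) (i j : Fin n) (a : Action) :
    (if S.adversary k j i = true then (countFloodSet n).send j (S.localState k j) a i else none) =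
      if S.adversary k j i = true then some (S.seen k j) else none := by
  split_ifs with h
  · rw [localState, if_pos (alive_of_delivered S.adversary_mem h)]
    rfl
  · rfl

theorem update_localState (S : Scenario n t) (k : ℕ) (i : Fin n) (a : Action) :
    (countFloodSet n).update i (S.localState k i) S.adversary a
      (fun j => if S.adversary k j i = true then some (S.seen k j) else none) =
      S.localState (k + 1) i := by
  have hseen : S.seen (k + 1) i = S.seen k i ∪ Finset.univ.biUnion fun j =>
      (if S.adversary k j i = true then some (S.seen k j) else none).getD ∅ := by
    simp only [seen, heardFrom, Finset.image_union, Finset.biUnion_image,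
      apply_ite (Option.getD · ∅), apply_ite (Finset.image S.values), Finset.image_empty,
      Option.getD_some, Option.getD_none]
  have hmissing : missingCount S.adversary (k + 1) i = (Finset.univ.filter fun j =>
      (if S.adversary k j i = true then some (S.seen k j) else none) = none).card := by
    simp only [missingCount, ite_eq_right_iff, reduceCtorEq, imp_false, Bool.not_eq_true]
  by_cases hk : Alive S.adversary k i
  · simp only [localState, countFloodSet, hk, alive_succ, hseen, hmissing, if_true, true_and,
      Option.bind_some]
    cases S.adversary k i i <;> rfl
  · simp only [localState, countFloodSet, hk, alive_succ, if_false, false_and, Option.bind_none]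

theorem Initiates.loc_eq {P : DecisionProtocol (countFloodSet n)} {r : Run (countFloodSet n)}
    (hr : r ∈ system (countFloodSet n) t P) (h : S.Initiates r) (k : ℕ) (i : Fin n) :
    (r k).loc i = S.localState k i := by
  suffices (r k).env = S.adversary ∧ ∀ i, (r k).loc i = S.localState k i from this.2 i
  induction k with
  | zero => exact ⟨h.1, fun i => (h.2 i).trans (if_pos (alive_zero _ i)).symm⟩
  | succ k ih =>
    obtain ⟨henv, hloc⟩ := ih
    rw [hr.2.2 k]
    refine ⟨henv, fun i => ?_⟩
    rw [step, henv, funext hloc]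
    exact (congrArg ((countFloodSet n).update i (S.localState k i) S.adversary _)
      (funext fun j => S.send_localState k i j _)).trans
      (S.update_localState k i (P i (S.localState k i)))

theorem Initiates.loc_eq_some_iff {P : DecisionProtocol (countFloodSet n)}
    {r : Run (countFloodSet n)} (hr : r ∈ system (countFloodSet n) t P) (h : S.Initiates r)
    {s : CountState} : (r k).loc i = some s ↔
      Alive S.adversary k i ∧ ⟨S.seen k i, missingCount S.adversary k i, k, S.values i⟩ = s := by
  rw [h.loc_eq hr]
  exact localState_eq_some_iff

theorem Initiates.existsValue_iff {r : Run (countFloodSet n)} (h : S.Initiates r) :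
    existsValue w r k ↔ ∃ i, S.values i = w := by
  refine exists_congr fun i => ?_
  rw [h.2 i]
  exact ((countFloodSet n).initState_injective i).eq_iff

theorem Initiates.of_corresponds {r r' : Run (countFloodSet n)} (h : S.Initiates r)
    (hrr' : Corresponds r r') : S.Initiates r' :=
  ⟨hrr'.2.symm.trans h.1, fun i => (hrr'.1 i _).1 (h.2 i)⟩

theorem exists_initiates {P : DecisionProtocol (countFloodSet n)} {r : Run (countFloodSet n)}
    (hr : r ∈ system (countFloodSet n) t P) : ∃ S : Scenario n t, S.Initiates r := by
  choose x hx using hr.2.1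
  exact ⟨⟨x, (r 0).env, hr.1⟩, rfl, hx⟩

theorem exists_run (S : Scenario n t) (P : DecisionProtocol (countFloodSet n)) :
    ∃ r ∈ system (countFloodSet n) t P, S.Initiates r :=
  ⟨fun k => Nat.rec ⟨S.adversary, fun i => (countFloodSet n).initState i (S.values i)⟩
      (fun k g => step _ P k g) k,
    ⟨S.adversary_mem, fun i => ⟨S.values i, rfl⟩, fun _ => rfl⟩, rfl, fun _ => rfl⟩

end Scenario

end Scenarios

section CommonKnowledge

variable {E : InfoExchange n} {R : Set (Run E)} {φ : Proposition E} {r : Run E} {m : ℕ} {i : Fin n}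

theorem CommonKnowledge.of_loc_eq {r' : Run E} {m' : ℕ} (h : CommonKnowledge R φ r m)
    (hi : i ∈ nonfailed r m) (hr' : r' ∈ R) (hloc : (r m).loc i = (r' m').loc i) :
    CommonKnowledge R φ r' m' := by
  intro k hk
  have hknown := h (k + 1) (hk.trans k.le_succ)
  rw [Function.iterate_succ_apply'] at hknown
  exact hknown i hi r' hr' m' hloc

theorem CommonKnowledge.holds (h : CommonKnowledge R φ r m) (hi : i ∈ nonfailed r m) (hr : r ∈ R) :
    φ r m := h 1 le_rfl i hi r hr m rfl

theorem CommonKnowledge.of_invariant (ψ : Proposition E)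
    (himp : ∀ r ∈ R, ∀ m, ψ r m → φ r m)
    (hknown : ∀ r ∈ R, ∀ m, ψ r m → EveryoneKnows R ψ r m)
    (hr : r ∈ R) (h : ψ r m) : CommonKnowledge R φ r m := by
  suffices ∀ k, (EveryoneKnows R)^[k] φ r m from fun k _ => this k
  intro k
  induction k generalizing r m with
  | zero => exact himp r hr m h
  | succ k ih =>
    rw [Function.iterate_succ_apply']
    exact fun i hi r' hr' m' hloc => ih hr' (hknown r hr m h i hi r' hr' m' hloc)

/-- In an SBA protocol, "some agent decides `w` now" is an invariant that every nonfailed agent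
knows. -/
theorem IsSBA.commonKnowledge {t : ℕ} {P : DecisionProtocol E} (hP : IsSBA E t P)
    (hr : r ∈ system E t P) {w : Value} (h : Decides P r m i w) :
    CommonKnowledge (system E t P) (existsValue w) r m := by
  refine .of_invariant (fun r m => ∃ i, Decides P r m i w) ?_ ?_ hr ⟨i, h⟩
  · rintro r hr m ⟨i, hi⟩
    exact hP.validity r hr m i w hi
  · rintro r hr m ⟨i, hi⟩ j hj r' - m' hloc
    obtain ⟨w', hw'⟩ := hP.simultaneity r hr m i w hi j hj
    obtain rfl := hP.agreement r hr m m i j w w' hi hw'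
    exact ⟨j, hloc.symm.trans_ne hj, hloc ▸ hw'.2⟩

end CommonKnowledge

section Sufficiency

/-- The condition on the local state under which the Counting FloodSet rule decides. -/
def CountState.Ready (n t : ℕ) (s : CountState) : Prop :=
  min (t + 1) (n - 1) ≤ s.time ∨ n - 1 ≤ s.missing

variable {P : DecisionProtocol (countFloodSet n)} {r : Run (countFloodSet n)} {m m' : ℕ}
  {i j : Fin n} {s s' : CountState} {w : Value}

theorem mem_nonfailed_iff : i ∈ nonfailed r m ↔ ∃ s, (r m).loc i = some s :=
  Option.ne_none_iff_exists'

theorem time_eq (hr : r ∈ system (countFloodSet n) t P) (hi : (r m).loc i = some s) :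
    s.time = m := by
  obtain ⟨S, hS⟩ := Scenario.exists_initiates hr
  obtain ⟨-, rfl⟩ := (hS.loc_eq_some_iff hr).1 hi
  rfl

theorem seen_nonempty (hr : r ∈ system (countFloodSet n) t P) (hi : (r m).loc i = some s) :
    s.seen.Nonempty := by
  obtain ⟨S, hS⟩ := Scenario.exists_initiates hr
  obtain ⟨-, rfl⟩ := (hS.loc_eq_some_iff hr).1 hi
  exact ⟨_, S.value_mem_seen m i⟩

theorem existsValue_of_mem_seen (hr : r ∈ system (countFloodSet n) t P)
    (hi : (r m).loc i = some s) (hw : w ∈ s.seen) : existsValue w r m := by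
  obtain ⟨S, hS⟩ := Scenario.exists_initiates hr
  obtain ⟨-, rfl⟩ := (hS.loc_eq_some_iff hr).1 hi
  obtain ⟨j, -, hj⟩ := Finset.mem_image.1 hw
  exact hS.existsValue_iff.2 ⟨j, hj⟩

theorem seen_eq_of_ready (hr : r ∈ system (countFloodSet n) t P) (hi : (r m).loc i = some s)
    (hs : s.Ready n t) (hm : m ≤ m') (hj : (r m').loc j = some s') : s'.seen = s.seen := by
  obtain ⟨S, hS⟩ := Scenario.exists_initiates hr
  obtain ⟨halive, rfl⟩ := (hS.loc_eq_some_iff hr).1 hi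
  obtain ⟨halive', rfl⟩ := (hS.loc_eq_some_iff hr).1 hj
  have huniform : HeardUniformly S.adversary m := by
    obtain htime | hmissing := hs
    · exact heardUniformly_of_min_le S.adversary_mem htime
    · have honly {a : Fin n} (ha : Alive S.adversary m a) : i = a :=
        eq_of_le_missingCount S.adversary_mem hmissing halive ha
      exact fun a b ha hb => by rw [← honly ha, ← honly hb]
  exact congrArg (Finset.image S.values) (huniform.heardFrom_eq S.adversary_mem hm halive halive')

theorem ready_of_ready (hr : r ∈ system (countFloodSet n) t P) (hi : (r m).loc i = some s)
    (hs : s.Ready n t) (hj : (r m).loc j = some s') : s'.Ready n t := by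
  obtain ⟨S, hS⟩ := Scenario.exists_initiates hr
  obtain ⟨halive, rfl⟩ := (hS.loc_eq_some_iff hr).1 hi
  obtain ⟨halive', rfl⟩ := (hS.loc_eq_some_iff hr).1 hj
  obtain htime | hmissing := hs
  · exact .inl htime
  · exact .inr (eq_of_le_missingCount S.adversary_mem hmissing halive halive' ▸ hmissing)

theorem commonKnowledge_of_ready (hr : r ∈ system (countFloodSet n) t P)
    (hi : (r m).loc i = some s) (hs : s.Ready n t) (hw : w ∈ s.seen) :
    CommonKnowledge (system (countFloodSet n) t P) (existsValue w) r m := by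
  refine .of_invariant (fun r m => ∃ i s, (r m).loc i = some s ∧ s.Ready n t ∧ w ∈ s.seen)
    ?_ ?_ hr ⟨i, s, hi, hs, hw⟩
  · rintro r hr m ⟨i, s, hi, -, hw⟩
    exact existsValue_of_mem_seen hr hi hw
  · rintro r hr m ⟨i, s, hi, hs, hw⟩ j hj r' - m' hloc
    obtain ⟨s', hj⟩ := mem_nonfailed_iff.1 hj
    exact ⟨j, s', hloc ▸ hj, ready_of_ready hr hi hs hj, seen_eq_of_ready hr hi hs le_rfl hj ▸ hw⟩

end Sufficiency

section Similarity

/-- Some live agent has the same local state at time `m` in both scenarios. -/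
def Similar (m : ℕ) (S S' : Scenario n t) : Prop :=
  ∃ i s, S.localState m i = some s ∧ S'.localState m i = some s

/-- Two scenarios are linked at time `m` if they are joined by a chain of scenarios each of which
is similar to the next: what is commonly known in one of them then holds in the other. -/
def Linked (m : ℕ) : Scenario n t → Scenario n t → Prop := Relation.TransGen (Similar m)

variable {S S' S'' : Scenario n t} {k m : ℕ} {i j : Fin n}

theorem Similar.symm (h : Similar m S S') : Similar m S' S :=
  let ⟨i, s, hi, hi'⟩ := h
  ⟨i, s, hi', hi⟩

theorem Similar.linked (h : Similar m S S') : Linked m S S' := .single h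

theorem Linked.symm (h : Linked m S S') : Linked m S' S :=
  have : Std.Symm (Similar (n := n) (t := t) m) := ⟨fun _ _ => Similar.symm⟩
  Relation.TransGen.stdSymm.symm _ _ h

theorem Linked.trans (h : Linked m S S') (h' : Linked m S' S'') : Linked m S S'' :=
  Relation.TransGen.trans h h'

theorem similar_of_eq (hi : Alive S.adversary m i) (hi' : Alive S'.adversary m i)
    (hvalue : S.values i = S'.values i) (hseen : S.seen m i = S'.seen m i)
    (hmissing : missingCount S.adversary m i = missingCount S'.adversary m i) : Similar m S S' :=
  ⟨i, _, if_pos hi, by rw [hvalue, hseen, hmissing]; exact if_pos hi'⟩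

theorem similar_zero (hvalue : S.values i = S'.values i) : Similar 0 S S' :=
  similar_of_eq (alive_zero _ i) (alive_zero _ i) hvalue
    (by simp only [Scenario.seen, heardFrom, Finset.image_singleton, hvalue]) rfl

theorem CommonKnowledge.of_linked {P : DecisionProtocol (countFloodSet n)}
    {φ : Proposition (countFloodSet n)} {r r' : Run (countFloodSet n)}
    (h : CommonKnowledge (system (countFloodSet n) t P) φ r m)
    (hr : r ∈ system (countFloodSet n) t P) (hS : S.Initiates r)
    (hr' : r' ∈ system (countFloodSet n) t P) (hS' : S'.Initiates r') (hSS' : Linked m S S') :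
    CommonKnowledge (system (countFloodSet n) t P) φ r' m := by
  have of_similar {S S' : Scenario n t} {r r' : Run (countFloodSet n)}
      (hr : r ∈ system (countFloodSet n) t P) (hS : S.Initiates r)
      (hr' : r' ∈ system (countFloodSet n) t P) (hS' : S'.Initiates r') (hSS' : Similar m S S')
      (h : CommonKnowledge (system (countFloodSet n) t P) φ r m) :
      CommonKnowledge (system (countFloodSet n) t P) φ r' m := by
    obtain ⟨i, s, hi, hi'⟩ := hSS'
    have hloc := (hS.loc_eq hr m i).trans hi
    exact h.of_loc_eq (mem_nonfailed_iff.2 ⟨s, hloc⟩) hr'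
      (hloc.trans ((hS'.loc_eq hr' m i).trans hi').symm)
  induction hSS' generalizing r' with
  | single hSS' => exact of_similar hr hS hr' hS' hSS' h
  | @tail S₁ S₂ _ hS₁S₂ ih =>
    obtain ⟨r₁, hr₁, hS₁⟩ := S₁.exists_run P
    exact of_similar hr₁ hS₁ hr' hS' hS₁S₂ (ih hr₁ hS₁)

/-- The scenario with the adversary of `S` in which only the values that `i` has seen by time `k`
occur; `i` cannot tell it from `S`. -/
def Scenario.restrictSeen (S : Scenario n t) (k : ℕ) (i : Fin n) : Scenario n t where
  values j := if j ∈ heardFrom S.adversary k i then S.values j else S.values i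
  adversary := S.adversary
  adversary_mem := S.adversary_mem

theorem Scenario.seen_restrictSeen (S : Scenario n t) (k : ℕ) (i : Fin n) :
    (S.restrictSeen k i).seen k i = S.seen k i :=
  Finset.image_congr fun _ hj => if_pos hj

theorem Scenario.image_values_restrictSeen (S : Scenario n t) (k : ℕ) (i : Fin n) :
    Finset.univ.image (S.restrictSeen k i).values = S.seen k i := by
  refine (Finset.image_subset_iff.2 fun j _ => ?_).antisymm
    ((S.seen_restrictSeen k i).symm.subset.trans (Finset.image_subset_image (Finset.subset_univ _)))
  dsimp only [restrictSeen]
  split_ifs with hj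
  exacts [Finset.mem_image_of_mem _ hj, S.value_mem_seen k i]

theorem similar_restrictSeen (hi : Alive S.adversary m i) : Similar m S (S.restrictSeen m i) :=
  similar_of_eq hi hi (if_pos (self_mem_heardFrom _ m i)).symm (S.seen_restrictSeen m i).symm rfl

/-- The scenario without crashes. -/
def noFailure (t : ℕ) (x : Fin n → Value) : Scenario n t where
  values := x
  adversary _ _ _ := true
  adversary_mem := by refine ⟨?_, ?_, ?_⟩ <;> simp

theorem alive_noFailure (x : Fin n → Value) (k : ℕ) (i : Fin n) :
    Alive (noFailure t x).adversary k i := fun _ _ => rfl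

theorem missingCount_noFailure (x : Fin n → Value) (k : ℕ) (i : Fin n) :
    missingCount (noFailure t x).adversary k i = 0 := by
  cases k <;> simp [missingCount, noFailure]

theorem seen_noFailure (x : Fin n → Value) (k : ℕ) (i : Fin n) :
    (noFailure t x).seen (k + 1) i = Finset.univ.image x :=
  congrArg (Finset.image x) <| Finset.eq_univ_of_forall fun _ =>
    mem_heardFrom_succ_of_delivered rfl

/-- The adversary for which the agents in `T` crash in the round that starts at time `k`, and only
their messages to `i` and to themselves are lost in that round: of the agents that do not crash,
only `i` can notice the crashes at time `k + 1`. -/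
def crashTowards (k : ℕ) (i : Fin n) (T : Finset (Fin n)) : Adversary n := fun k' a c =>
  !decide (a ∈ T ∧ (k < k' ∨ k' = k ∧ (c = i ∨ c = a)))

variable {T : Finset (Fin n)}

theorem crashTowards_eq_false {k' : ℕ} {a c : Fin n} :
    crashTowards k i T k' a c = false ↔ a ∈ T ∧ (k < k' ∨ k' = k ∧ (c = i ∨ c = a)) := by
  rw [crashTowards, Bool.not_eq_false', decide_eq_true_eq]

theorem crashTowards_mem_crash (hT : T.card ≤ t) : crashTowards k i T ∈ Crash n t := by
  refine ⟨fun k' a c => ?_, fun k' a h k'' hk'' c => ?_, le_trans ?_ hT⟩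
  · simp only [crashTowards_eq_false]
    tauto
  · rw [crashTowards_eq_false] at h ⊢
    exact ⟨h.1, .inl (by omega)⟩
  · rw [← Set.ncard_coe_finset]
    refine Set.ncard_le_ncard ?_ (Set.toFinite _)
    rintro a ⟨k', c, h⟩
    exact (crashTowards_eq_false.1 h).1

theorem crashTowards_eq_true {k' : ℕ} {a c : Fin n} (ha : a ∉ T) :
    crashTowards k i T k' a c = true := by
  simp [crashTowards, ha]

theorem alive_crashTowards {a : Fin n} (ha : a ∉ T) : Alive (crashTowards k i T) m a :=
  fun _ _ => crashTowards_eq_true ha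

theorem missingCount_crashTowards : missingCount (crashTowards k i T) (k + 1) i = T.card := by
  rw [missingCount]
  congr 1
  ext a
  simp [crashTowards_eq_false]

theorem missingCount_crashTowards_of_ne (hj : j ∉ T) (hij : j ≠ i) :
    missingCount (crashTowards k i T) (k + 1) j = 0 := by
  rw [missingCount, Finset.card_eq_zero, Finset.filter_eq_empty_iff]
  intro a _ hlost
  obtain ⟨ha, hlt | ⟨-, rfl | rfl⟩⟩ := crashTowards_eq_false.1 hlost
  exacts [hlt.ne rfl, hij rfl, hj ha]

theorem exists_image_univ_subset_pair (hn : 2 ≤ n) (x : Fin n → Value) (i : Fin n) :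
    ∃ j ≠ i, Finset.univ.image x ⊆ {x i, x j} := by
  by_cases hx : ∃ j, x j ≠ x i
  · obtain ⟨j, hj⟩ := hx
    have pair_eq_univ : ∀ v w : Value, w ≠ v → ({v, w} : Finset Value) = Finset.univ := by decide
    exact ⟨j, ne_of_apply_ne x hj, pair_eq_univ _ _ hj ▸ Finset.subset_univ _⟩
  · push Not at hx
    have : Nontrivial (Fin n) := Fin.nontrivial_iff_two_le.2 hn
    obtain ⟨j, hj⟩ := exists_ne i
    exact ⟨j, hj, Finset.image_subset_iff.2 fun a _ => by simp [hx a]⟩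

theorem Scenario.seen_succ_eq_image_univ (h : S.adversary k j i = true)
    (hij : Finset.univ.image S.values ⊆ {S.values i, S.values j}) :
    S.seen (k + 1) i = Finset.univ.image S.values := by
  refine (Finset.image_subset_image (Finset.subset_univ _)).antisymm (hij.trans ?_)
  rw [Finset.insert_subset_iff, Finset.singleton_subset_iff]
  exact ⟨S.value_mem_seen _ i, Finset.mem_image_of_mem _ (mem_heardFrom_succ_of_delivered h)⟩

/-- `i` cannot exclude that exactly the agents it missed crashed towards `i` in the last round. An
agent whose message `i` received then believes that there was no crash. -/
theorem linked_noFailure_of_seen_eq (hi : Alive S.adversary (k + 1) i)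
    (hmissing : missingCount S.adversary (k + 1) i + 2 ≤ n)
    (hseen : S.seen (k + 1) i = Finset.univ.image S.values) :
    Linked (k + 1) S (noFailure t S.values) := by
  obtain ⟨j, hji, hpair⟩ := exists_image_univ_subset_pair (by omega) S.values i
  obtain ⟨T, hT, hTcard⟩ :
      ∃ T ⊆ Finset.univ \ {i, j}, T.card = missingCount S.adversary (k + 1) i := by
    refine Finset.exists_subset_card_eq ?_
    rw [Finset.card_sdiff_of_subset (Finset.subset_univ _), Finset.card_pair hji.symm,
      Finset.card_univ, Fintype.card_fin]
    omega
  have hiT : i ∉ T := fun h => by simpa using hT h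
  have hjT : j ∉ T := fun h => by simpa using hT h
  let G : Scenario n t := ⟨S.values, crashTowards k i T,
    crashTowards_mem_crash (hTcard ▸ missingCount_le S.adversary_mem _ _)⟩
  have hSG : Similar (k + 1) S G :=
    similar_of_eq hi (alive_crashTowards hiT) rfl
      (hseen.trans (G.seen_succ_eq_image_univ (crashTowards_eq_true hjT) hpair).symm)
      (hTcard.symm.trans missingCount_crashTowards.symm)
  have hG : Similar (k + 1) G (noFailure t S.values) :=
    similar_of_eq (alive_crashTowards hjT) (alive_noFailure _ _ _) rfl
      ((G.seen_succ_eq_image_univ (crashTowards_eq_true hiT) (by rwa [Finset.pair_comm])).trans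
        (seen_noFailure _ _ _).symm)
      ((missingCount_crashTowards_of_ne hjT hji).trans (missingCount_noFailure _ _ _).symm)
  exact hSG.linked.trans hG.linked

theorem linked_noFailure_restrictSeen (hi : Alive S.adversary (k + 1) i)
    (hmissing : missingCount S.adversary (k + 1) i + 2 ≤ n) :
    Linked (k + 1) S (noFailure t (S.restrictSeen (k + 1) i).values) :=
  (similar_restrictSeen hi).linked.trans <| linked_noFailure_of_seen_eq hi hmissing <|
    (S.seen_restrictSeen _ i).trans (S.image_values_restrictSeen _ i).symm

theorem similar_noFailure {x y : Fin n → Value} (hi : x i = y i)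
    (himage : Finset.univ.image x = Finset.univ.image y) :
    Similar (k + 1) (noFailure t x) (noFailure t y) :=
  similar_of_eq (alive_noFailure _ _ i) (alive_noFailure _ _ i) hi
    (by rw [seen_noFailure, seen_noFailure, himage])
    (by rw [missingCount_noFailure, missingCount_noFailure])

theorem linked_noFailure_of_surjective (hn : 3 ≤ n) {x y : Fin n → Value} (hx : x.Surjective)
    (hy : y.Surjective) : Linked (k + 1) (noFailure t x) (noFailure t y) := by
  obtain ⟨a, b, hab, hxab⟩ :=
    Fintype.exists_ne_map_eq_of_card_lt x (by rwa [Fintype.card_fin, Fintype.card_fin])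
  let z := Function.update x a (y a)
  have hz : z.Surjective := fun v => by
    obtain ⟨c, rfl⟩ := hx v
    by_cases hc : c = a
    · exact ⟨b, by rw [hc, hxab]; exact Function.update_of_ne hab.symm _ _⟩
    · exact ⟨c, Function.update_of_ne hc _ _⟩
  have hxz : Similar (k + 1) (noFailure t x) (noFailure t z) :=
    similar_noFailure (Function.update_of_ne hab.symm _ _).symm
      ((Finset.image_univ_of_surjective hx).trans (Finset.image_univ_of_surjective hz).symm)
  have hzy : Similar (k + 1) (noFailure t z) (noFailure t y) :=
    similar_noFailure (Function.update_self a _ _)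
      ((Finset.image_univ_of_surjective hz).trans (Finset.image_univ_of_surjective hy).symm)
  exact hxz.linked.trans hzy.linked

end Similarity

section CrashChain

variable {k m : ℕ} {i : Fin n}

/-- The adversary for which agent `k` crashes in the round that starts at time `k`, for each
`k < m`, and only its message to agent `k + 1` is delivered in that round. The initial value of
agent `0` thus reaches agent `m` by time `m`, but no later agent. -/
def crashChain (n m : ℕ) : Adversary n := fun k i j =>
  decide (k < (i : ℕ) ∨ m ≤ (i : ℕ) ∨ (i : ℕ) = k ∧ (j : ℕ) = k + 1)

theorem crashChain_eq_true {j : Fin n} : crashChain n m k i j = true ↔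
    k < (i : ℕ) ∨ m ≤ (i : ℕ) ∨ (i : ℕ) = k ∧ (j : ℕ) = k + 1 :=
  decide_eq_true_iff

theorem crashChain_mem_crash (n m : ℕ) : crashChain n m ∈ Crash n m := by
  refine ⟨fun k i j h => ?_, fun k i h k' hk' j => ?_, ?_⟩
  · rw [crashChain, decide_eq_false_iff_not] at h ⊢
    omega
  · rw [crashChain, decide_eq_false_iff_not] at h ⊢
    omega
  · calc {i : Fin n | ∃ k j, crashChain n m k i j = false}.ncard
        ≤ (Finset.univ.filter fun i : Fin n => (i : ℕ) < m).card := by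
          rw [← Set.ncard_coe_finset]
          refine Set.ncard_le_ncard ?_ (Set.toFinite _)
          rintro i ⟨k, j, h⟩
          rw [crashChain, decide_eq_false_iff_not] at h
          simp only [Finset.coe_filter, Finset.mem_univ, true_and, Set.mem_ofPred_eq]
          omega
      _ ≤ m := by
          rw [Fin.card_filter_val_lt]
          exact min_le_right n m

theorem Crash.mono {t t' : ℕ} (h : t ≤ t') : Crash n t ⊆ Crash n t' :=
  fun _ hF => ⟨hF.1, hF.2.1, hF.2.2.trans h⟩

theorem alive_crashChain (hi : m ≤ (i : ℕ)) : Alive (crashChain n m) k i :=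
  fun _ _ => crashChain_eq_true.2 (.inr (.inl hi))

theorem zero_mem_heardFrom_crashChain [NeZero n] (hi : (i : ℕ) = k) :
    0 ∈ heardFrom (crashChain n m) k i := by
  induction k generalizing i with
  | zero => exact Finset.mem_singleton.2 (Fin.ext hi.symm)
  | succ k ih =>
    have hpred : crashChain n m k ⟨k, by omega⟩ i = true :=
      crashChain_eq_true.2 (.inr (.inr ⟨rfl, hi⟩))
    exact mem_heardFrom_succ.2 (.inr ⟨_, hpred, ih rfl⟩)

theorem zero_notMem_heardFrom_crashChain [NeZero n] (hk : k ≤ m) (hi : k < (i : ℕ)) :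
    0 ∉ heardFrom (crashChain n m) k i := by
  induction k generalizing i with
  | zero => exact fun h => hi.ne (congrArg Fin.val (Finset.mem_singleton.1 h))
  | succ k ih =>
    rw [mem_heardFrom_succ]
    rintro (h | ⟨j, hj, h⟩)
    · exact ih (by omega) (by omega) h
    · rw [crashChain_eq_true] at hj
      exact ih (by omega) (by omega) h

end CrashChain

section Necessity

variable {S : Scenario n t} {k m : ℕ} {i : Fin n}

theorem surjective_of_ne {α : Type*} {f : α → Value} {a b : α} (h : f a ≠ f b) : f.Surjective := by
  intro v
  have eq_or_eq : ∀ u w : Value, u ≠ w → u = v ∨ w = v := by decide +revert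
  obtain ha | hb := eq_or_eq _ _ h
  exacts [⟨a, ha⟩, ⟨b, hb⟩]

/-- Under `crashChain`, with agent `0` alone holding a value other than `b`, agent `k + 1` has seen
both values at time `k + 1`, and agent `k + 2` only `b`. -/
theorem linked_const_of_surjective (hkt : k + 1 ≤ t) (hkn : k + 3 ≤ n) (b : Value)
    {y : Fin n → Value} (hy : y.Surjective) :
    Linked (k + 1) (noFailure t fun _ => b) (noFailure t y) := by
  have : NeZero n := ⟨by omega⟩
  obtain ⟨c, hc⟩ := exists_ne b
  let S : Scenario n t := ⟨fun j => if j = 0 then c else b, crashChain n (k + 1),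
    Crash.mono hkt (crashChain_mem_crash n (k + 1))⟩
  have hmissing (i : Fin n) : missingCount S.adversary (k + 1) i + 2 ≤ n := by
    have hcrashed : missingCount S.adversary (k + 1) i ≤ k + 1 :=
      missingCount_le (crashChain_mem_crash n (k + 1)) (k + 1) i
    omega
  have hlinked (i : Fin n) (hi : k + 1 ≤ (i : ℕ)) :=
    linked_noFailure_restrictSeen (S := S) (alive_crashChain hi) (hmissing i)
  have values_zero : S.values 0 = c := by simp [S]
  have values_of_ne_zero {i : Fin n} (hi : i ≠ 0) : S.values i = b := if_neg hi
  let p : Fin n := ⟨k + 1, by omega⟩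
  let q : Fin n := ⟨k + 2, by omega⟩
  have hp : (S.restrictSeen (k + 1) p).values.Surjective := by
    have h0 : (S.restrictSeen (k + 1) p).values 0 = c :=
      (if_pos (zero_mem_heardFrom_crashChain (i := p) rfl)).trans values_zero
    have hpb : (S.restrictSeen (k + 1) p).values p = b :=
      (if_pos (self_mem_heardFrom _ _ p)).trans
        (values_of_ne_zero (Fin.ne_of_val_ne k.succ_ne_zero))
    exact surjective_of_ne (h0.trans_ne (hc.trans_eq hpb.symm))
  have hq : (S.restrictSeen (k + 1) q).values = fun _ => b := by
    funext j
    dsimp only [Scenario.restrictSeen]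
    split_ifs with hj
    · refine values_of_ne_zero fun hj0 => ?_
      exact zero_notMem_heardFrom_crashChain le_rfl (Nat.lt_succ_self _) (hj0 ▸ hj)
    · exact values_of_ne_zero (Fin.ne_of_val_ne (k + 1).succ_ne_zero)
  rw [← hq]
  exact (hlinked q (Nat.le_succ _)).symm.trans
    ((hlinked p le_rfl).trans (linked_noFailure_of_surjective (by omega) hp hy))

theorem linked_noFailure_const (hkt : k + 1 ≤ t) (hkn : k + 3 ≤ n) (x : Fin n → Value)
    (b : Value) : Linked (k + 1) (noFailure t x) (noFailure t fun _ => b) := by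
  by_cases hx : ∃ i j, x i ≠ x j
  · obtain ⟨i, j, hij⟩ := hx
    exact (linked_const_of_surjective hkt hkn b (surjective_of_ne hij)).symm
  · push Not at hx
    have hconst : x = fun _ => x ⟨0, by omega⟩ := funext fun i => hx i _
    obtain ⟨y, hy⟩ : ∃ y : Fin n → Value, y.Surjective :=
      ⟨fun i => if (i : ℕ) = 0 then 0 else 1,
        surjective_of_ne (a := ⟨0, by omega⟩) (b := ⟨1, by omega⟩) (by simp)⟩
    rw [hconst]
    exact (linked_const_of_surjective hkt hkn _ hy).trans
      (linked_const_of_surjective hkt hkn b hy).symm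

theorem linked_const_of_not_ready {s : CountState} (hi : S.localState m i = some s)
    (hs : ¬ s.Ready n t) (b : Value) : Linked m S (noFailure t fun _ => b) := by
  obtain ⟨halive, rfl⟩ := Scenario.localState_eq_some_iff.1 hi
  obtain ⟨hearly, hmissing⟩ := not_or.1 hs
  obtain ⟨hmt, hmn⟩ : m < t + 1 ∧ m < n - 1 := lt_min_iff.1 (not_le.1 hearly)
  cases m with
  | zero =>
    have : Nontrivial (Fin n) := Fin.nontrivial_iff_two_le.2 (by omega)
    obtain ⟨j, hj⟩ := exists_ne i
    let S' := noFailure t fun a => if a = i then S.values i else b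
    have hSS' : Similar 0 S S' := similar_zero (i := i) (if_pos rfl).symm
    have hS' : Similar 0 S' (noFailure t fun _ => b) := similar_zero (if_neg hj)
    exact hSS'.linked.trans hS'.linked
  | succ k =>
    have hmissing : missingCount S.adversary (k + 1) i < n - 1 := not_le.1 hmissing
    exact (linked_noFailure_restrictSeen halive (by omega)).trans
      (linked_noFailure_const (by omega) (by omega) _ b)

end Necessity

section Rule

variable {P : DecisionProtocol (countFloodSet n)} {r : Run (countFloodSet n)} {m : ℕ} {i : Fin n}
  {s : CountState} {v w : Value}

theorem commonKnowledge_existsValue_iff (hr : r ∈ system (countFloodSet n) t P)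
    (hi : (r m).loc i = some s) :
    CommonKnowledge (system (countFloodSet n) t P) (existsValue w) r m ↔
      s.Ready n t ∧ w ∈ s.seen := by
  obtain ⟨S, hS⟩ := Scenario.exists_initiates hr
  have hlocal : S.localState m i = some s := (hS.loc_eq hr m i).symm.trans hi
  obtain ⟨halive, rfl⟩ := Scenario.localState_eq_some_iff.1 hlocal
  refine ⟨fun hck => ?_, fun h => commonKnowledge_of_ready hr hi h.1 h.2⟩
  have exists_values_eq (S' : Scenario n t) (hi' : Alive S'.adversary m i) (hSS' : Linked m S S') :
      ∃ j, S'.values j = w := by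
    obtain ⟨r', hr', hS'⟩ := S'.exists_run P
    have hnonfailed := mem_nonfailed_iff.2 ⟨_, (hS'.loc_eq_some_iff hr').2 ⟨hi', rfl⟩⟩
    exact hS'.existsValue_iff.1 ((hck.of_linked hr hS hr' hS' hSS').holds hnonfailed hr')
  constructor
  · by_contra hready
    obtain ⟨b, hb⟩ := exists_ne w
    obtain ⟨_, hbw⟩ := exists_values_eq (noFailure t fun _ => b) (alive_noFailure _ m i)
      (linked_const_of_not_ready hlocal hready b)
    exact hb hbw
  · obtain ⟨j, hj⟩ :=
      exists_values_eq (S.restrictSeen m i) halive (similar_restrictSeen halive).linked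
    change w ∈ S.seen m i
    rw [← S.image_values_restrictSeen, ← hj]
    exact Finset.mem_image_of_mem _ (Finset.mem_univ j)

theorem decides_countRule_iff : Decides (countRule n t) r m i v ↔
    ∃ s, (r m).loc i = some s ∧ s.Ready n t ∧ v = s.seen.inf id := by
  rw [Decides, mem_nonfailed_iff, ← exists_and_right]
  refine exists_congr fun s => and_congr_right fun hs => ?_
  rw [hs]
  dsimp only [countRule, CountState.Ready]
  split_ifs <;> simp_all [eq_comm]

theorem inf_id_mem {W : Finset Value} (hW : W.Nonempty) : W.inf id ∈ W := by
  decide +revert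

theorem isSBA_countRule (n t : ℕ) : IsSBA (countFloodSet n) t (countRule n t) where
  agreement r hr m m' i j v v' h h' := by
    wlog hm : m ≤ m' generalizing m m' i j v v'
    · exact (this m' m j i v' v h' h (le_of_not_ge hm)).symm
    obtain ⟨s, hi, hs, rfl⟩ := decides_countRule_iff.1 h
    obtain ⟨s', hj, -, rfl⟩ := decides_countRule_iff.1 h'
    rw [seen_eq_of_ready hr hi hs hm hj]
  validity r hr m i v h := by
    obtain ⟨s, hi, -, rfl⟩ := decides_countRule_iff.1 h
    exact existsValue_of_mem_seen hr hi (inf_id_mem (seen_nonempty hr hi))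
  simultaneity r hr m i v h j hj := by
    obtain ⟨s, hi, hs, -⟩ := decides_countRule_iff.1 h
    obtain ⟨s', hj⟩ := mem_nonfailed_iff.1 hj
    exact ⟨_, decides_countRule_iff.2 ⟨s', hj, ready_of_ready hr hi hs hj, rfl⟩⟩

theorem isOptimumSBA_countRule (n t : ℕ) :
    IsOptimumSBA (countFloodSet n) t (countRule n t) := by
  refine ⟨isSBA_countRule n t, fun P hP r hr r' hr' hrr' m i v h => ?_⟩
  obtain ⟨s, hi⟩ := mem_nonfailed_iff.1 h.1
  have hready : s.Ready n t := ((commonKnowledge_existsValue_iff hr hi).1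
    (hP.commonKnowledge hr h)).1
  obtain ⟨S, hS⟩ := Scenario.exists_initiates hr
  have hi' : (r' m).loc i = some s :=
    ((hS.of_corresponds hrr').loc_eq hr' m i).trans ((hS.loc_eq hr m i).symm.trans hi)
  exact ⟨_, decides_countRule_iff.2 ⟨s, hi', hready, rfl⟩⟩

theorem terminates_countRule (n t : ℕ) : Terminates (countFloodSet n) t (countRule n t) := by
  intro r hr i
  refine ⟨min (t + 1) (n - 1), or_iff_not_imp_left.2 fun hi => ?_⟩
  obtain ⟨s, hs⟩ := mem_nonfailed_iff.1 (not_not.1 hi)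
  exact ⟨_, decides_countRule_iff.2 ⟨s, hs, .inl (time_eq hr hs).ge, rfl⟩⟩

end Rule

end SBA

theorem mainTheorem5_general (n t : ℕ) :
    (∀ (P : SBA.DecisionProtocol (SBA.countFloodSet n)),
      ∀ r ∈ SBA.system (SBA.countFloodSet n) t P,
      ∀ (m : ℕ) (i : Fin n) (W : Finset SBA.Value) (h : ℕ) (v : SBA.Value),
        (r m).loc i = some (SBA.CountState.mk W h m v) →
        ∀ w : SBA.Value, SBA.CommonKnowledge (SBA.system (SBA.countFloodSet n) t P)
            (SBA.existsValue w) r m ↔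
          (min (t + 1) (n - 1) ≤ m ∨ n - 1 ≤ h) ∧ w ∈ W) ∧
    SBA.IsOptimumSBA (SBA.countFloodSet n) t (SBA.countRule n t) ∧
    SBA.Terminates (SBA.countFloodSet n) t (SBA.countRule n t) :=
  ⟨fun _ _ hr _ _ _ _ _ hs _ => SBA.commonKnowledge_existsValue_iff hr hs,
    SBA.isOptimumSBA_countRule n t, SBA.terminates_countRule n t⟩

theorem mainTheorem5 (n t : ℕ) (ht : t < n) :
    (∀ (P : SBA.DecisionProtocol (SBA.countFloodSet n)),
      ∀ r ∈ SBA.system (SBA.countFloodSet n) t P,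
      ∀ (m : ℕ) (i : Fin n) (W : Finset SBA.Value) (h : ℕ) (v : SBA.Value),
        (r m).loc i = some (SBA.CountState.mk W h m v) →
        ((∃ w : SBA.Value, SBA.CommonKnowledge (SBA.system (SBA.countFloodSet n) t P)
            (SBA.existsValue w) r m) ↔
          (min (t + 1) (n - 1) ≤ m ∨ n - 1 ≤ h))) ∧
    SBA.IsOptimumSBA (SBA.countFloodSet n) t (SBA.countRule n t) ∧
    SBA.Terminates (SBA.countFloodSet n) t (SBA.countRule n t) := by
  obtain ⟨hck, hoptimum, hterminates⟩ := mainTheorem5_general n t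
  refine ⟨fun P r hr m i W h v hs => ?_, hoptimum, hterminates⟩
  simp only [hck P r hr m i W h v hs, exists_and_left]
  exact and_iff_left (SBA.seen_nonempty hr hs)
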